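/- Let $n\in\mathbb{N}$ and let $A\in\mathbb{R}^{2n\times 2n}$ with $\operatorname{tr} A<0$. Then there exists a matrix $M\in\mathbb{R}^{2n\times 2n}$ that is skew-symmetric, i.e. $M^T=-M$, and Hamiltonian, i.e. of the form $$M=\begin{bmatrix}F&P\\Q&-F^T\end{bmatrix}$$ with $F,P,Q\in\mathbb{R}^{n\times n}$ and $P$, $Q$ symmetric, such that every complex eigenvalue $z$ of $A+M$ satisfies $\operatorname{Re} z<0$. -/

import Mathlib

/-- A real `2n × 2n` matrix, written in `n × n` blocks, is Hamiltonian if it has the form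
`[[F, P], [Q, -Fᵀ]]` with `F` arbitrary and `P`, `Q` symmetric. -/
def IsHamiltonianMatrix {n : ℕ} (H : Matrix (Fin n ⊕ Fin n) (Fin n ⊕ Fin n) ℝ) : Prop :=
  ∃ F P Q : Matrix (Fin n) (Fin n) ℝ,
    P.IsSymm ∧ Q.IsSymm ∧ H = Matrix.fromBlocks F P Q (-F.transpose)

/-! A skew-symmetric Hamiltonian matrix has the form `[[R, -S], [S, R]]` with `R + iS`
skew-Hermitian, and a fixed complex change of coordinates turns it into `diag(K, conj K)` with `K =
R + iS`. In these coordinates the diagonal blocks of `A` are `G / 2` and its conjugate, where `Re tr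
G = tr A`. A unitary `U` spreads this trace evenly, giving `Uᴴ G U` a diagonal of negative real part
(`exists_unitary_re_diag_eq`). With `K = U D Uᴴ` for `D` diagonal and imaginary, `A + tM` becomes
similar to `B + i t diag(l)` with distinct `l`. For large `t` the eigenvalues are close to `B a a +
i t l a`, hence stable (`exists_stable_add_diagonal`). -/

open Matrix in
/-- If the diagonal entries of `B` have negative real part and the frequencies `l` are separated,
then `B + i t diag(l)` is stable for a suitable `t`. -/
theorem exists_stable_add_diagonal {ι : Type*} [Fintype ι] [DecidableEq ι]
    (B : Matrix ι ι ℂ) (l : ι → ℝ) (hl : ∀ a b, a ≠ b → 1 ≤ |l a - l b|)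
    (hB : ∀ a, (B a a).re < 0) :
    ∃ t : ℝ, ∀ (z : ℂ) (v : ι → ℂ), v ≠ 0 →
      (B + diagonal fun a => (t : ℂ) * (Complex.I * (l a : ℂ))) *ᵥ v = z • v → z.re < 0 := by
  rcases isEmpty_or_nonempty ι with h | h
  · exact ⟨0, fun z v hv => absurd (Subsingleton.elim v 0) hv⟩
  obtain ⟨a₀, ha₀⟩ := Finite.exists_max fun a => (B a a).re
  set η : ℝ := -(B a₀ a₀).re with hη
  have hη0 : 0 < η := by have := hB a₀; linarith
  set R : ℝ := ∑ a, ∑ b, ‖B a b‖ with hR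
  have hR0 : 0 ≤ R := Finset.sum_nonneg fun a _ => Finset.sum_nonneg fun b _ => norm_nonneg _
  have hrow : ∀ a, ∑ b, ‖B a b‖ ≤ R := fun a =>
    Finset.single_le_sum (f := fun a => ∑ b, ‖B a b‖)
      (fun a _ => Finset.sum_nonneg fun b _ => norm_nonneg _) (Finset.mem_univ a)
  -- Chosen so that the off-diagonal error `R * R / (t - R)` in `hfin` is below `η`.
  set t : ℝ := R + R ^ 2 / η + 1 with ht
  have htR : R ^ 2 < η * (t - R) := by
    have : η * (t - R) = R ^ 2 + η := by rw [ht]; field_simp; ring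
    linarith
  have htR0 : 0 < t - R := by
    have : 0 ≤ R ^ 2 / η := by positivity
    rw [ht]; linarith
  refine ⟨t, fun z v hv hz => ?_⟩
  obtain ⟨k, hk⟩ := Finite.exists_max fun a => ‖v a‖
  have hm : 0 < ‖v k‖ := by
    obtain ⟨a, ha⟩ := Function.ne_iff.mp hv
    exact (norm_pos_iff.mpr ha).trans_le (hk a)
  have heq : ∀ a, ∑ b, B a b * v b = (z - t * (Complex.I * l a)) * v a := fun a => by
    have := congrFun hz a
    rw [add_mulVec, Pi.add_apply, mulVec_diagonal, Pi.smul_apply, smul_eq_mul] at this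
    rw [sub_mul, ← this]
    simp [mulVec, dotProduct]
  have hbd : ∀ a, ‖(z - t * (Complex.I * l a)) * v a‖ ≤ R * ‖v k‖ := fun a => by
    rw [← heq a]
    refine (norm_sum_le _ _).trans (le_trans ?_ (mul_le_mul_of_nonneg_right (hrow a) hm.le))
    rw [Finset.sum_mul]
    refine Finset.sum_le_sum fun b _ => ?_
    rw [norm_mul]
    exact mul_le_mul_of_nonneg_left (hk b) (norm_nonneg _)
  have hzk : ‖z - t * (Complex.I * l k)‖ ≤ R := by
    have := hbd k
    rw [norm_mul] at this
    exact le_of_mul_le_mul_right this hm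
  -- `z` lies within `R` of `i t l k`, hence at least `t - R` away from `i t l b`; row `b` then
  -- forces `v b` to be small.
  have hsmall : ∀ b, b ≠ k → (t - R) * ‖v b‖ ≤ R * ‖v k‖ := fun b hb => by
    refine le_trans ?_ (hbd b)
    rw [norm_mul]
    refine mul_le_mul_of_nonneg_right ?_ (norm_nonneg _)
    have h1 : ‖(t * (Complex.I * l b) - t * (Complex.I * l k) : ℂ)‖ = t * |l b - l k| := by
      rw [← mul_sub, ← mul_sub, norm_mul, norm_mul, Complex.norm_I, one_mul, ← Complex.ofReal_sub,
        Complex.norm_real, Complex.norm_real, Real.norm_eq_abs, Real.norm_eq_abs,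
        abs_of_nonneg (by linarith : 0 ≤ t)]
    have h2 : (t * (Complex.I * l b) - t * (Complex.I * l k) : ℂ)
        = (z - t * (Complex.I * l k)) - (z - t * (Complex.I * l b)) := by ring
    have h3 := norm_sub_le (z - t * (Complex.I * l k)) (z - t * (Complex.I * l b))
    rw [← h2, h1] at h3
    have h4 := le_mul_of_one_le_right (by linarith : 0 ≤ t) (hl b k hb)
    linarith
  -- Gershgorin's estimate on row `k`, sharpened by the smallness of the other coordinates.
  have hfin : ‖z - t * (Complex.I * l k) - B k k‖ < η := by
    have h1 : (z - t * (Complex.I * l k) - B k k) * v k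
        = ∑ b ∈ Finset.univ.erase k, B k b * v b := by
      rw [sub_mul, ← heq k, ← Finset.add_sum_erase _ _ (Finset.mem_univ k)]
      ring
    have h2 : (t - R) * ‖(z - t * (Complex.I * l k) - B k k) * v k‖ ≤ R * (R * ‖v k‖) := by
      rw [h1]
      calc (t - R) * ‖∑ b ∈ Finset.univ.erase k, B k b * v b‖
          ≤ (t - R) * ∑ b ∈ Finset.univ.erase k, ‖B k b * v b‖ :=
            mul_le_mul_of_nonneg_left (norm_sum_le _ _) htR0.le
        _ = ∑ b ∈ Finset.univ.erase k, ‖B k b‖ * ((t - R) * ‖v b‖) := by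
            rw [Finset.mul_sum]
            refine Finset.sum_congr rfl fun b _ => ?_
            rw [norm_mul]; ring
        _ ≤ ∑ b ∈ Finset.univ.erase k, ‖B k b‖ * (R * ‖v k‖) :=
            Finset.sum_le_sum fun b hb =>
              mul_le_mul_of_nonneg_left (hsmall b (Finset.ne_of_mem_erase hb)) (norm_nonneg _)
        _ = (∑ b ∈ Finset.univ.erase k, ‖B k b‖) * (R * ‖v k‖) := (Finset.sum_mul _ _ _).symm
        _ ≤ R * (R * ‖v k‖) := by
            refine mul_le_mul_of_nonneg_right (le_trans ?_ (hrow k)) (by positivity)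
            exact Finset.sum_le_sum_of_subset_of_nonneg (Finset.erase_subset _ _)
              fun b _ _ => norm_nonneg _
    rw [norm_mul] at h2
    by_contra! hc
    have h3 : (t - R) * (η * ‖v k‖) ≤ R * (R * ‖v k‖) :=
      (mul_le_mul_of_nonneg_left (mul_le_mul_of_nonneg_right hc hm.le) htR0.le).trans h2
    have h4 := mul_lt_mul_of_pos_right htR hm
    linarith
  have hre := (Complex.re_le_norm _).trans_lt hfin
  have hkk := ha₀ k
  simp at hre hkk
  linarith

open Matrix in
/-- The normalised discrete Fourier matrix: a unitary matrix with entries of equal modulus. -/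
theorem exists_unitary_normSq_eq (n : ℕ) :
    ∃ F : Matrix (Fin n) (Fin n) ℂ, Fᴴ * F = 1 ∧ ∀ j k, Complex.normSq (F j k) = 1 / n := by
  rcases Nat.eq_zero_or_pos n with rfl | hn
  · exact ⟨1, by simp, fun j => j.elim0⟩
  have hn0 : (n : ℂ) ≠ 0 := by exact_mod_cast hn.ne'
  obtain ⟨ζ, hζ⟩ : ∃ ζ : ℂ, IsPrimitiveRoot ζ n := ⟨_, Complex.isPrimitiveRoot_exp n hn.ne'⟩
  have hnorm : ‖ζ‖ = 1 := hζ.norm'_eq_one hn.ne'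
  have hζ0 : ζ ≠ 0 := hζ.ne_zero hn.ne'
  have hconj : star ζ = ζ⁻¹ := (Complex.inv_eq_conj hnorm).symm
  have hsq : ((Real.sqrt n : ℝ) : ℂ) * ((Real.sqrt n : ℝ) : ℂ) = n := by
    rw [← Complex.ofReal_mul, Real.mul_self_sqrt (Nat.cast_nonneg n)]; simp
  refine ⟨Matrix.of fun j k => ((Real.sqrt n : ℝ) : ℂ)⁻¹ * ζ ^ ((j : ℕ) * (k : ℕ)), ?_, ?_⟩
  · ext k l
    rw [mul_apply]
    have hterm : ∀ j : Fin n, (Matrix.of fun j k : Fin n =>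
          ((Real.sqrt n : ℝ) : ℂ)⁻¹ * ζ ^ ((j : ℕ) * (k : ℕ)))ᴴ k j *
        (Matrix.of fun j k : Fin n =>
          ((Real.sqrt n : ℝ) : ℂ)⁻¹ * ζ ^ ((j : ℕ) * (k : ℕ))) j l
        = (n : ℂ)⁻¹ * (ζ ^ ((l : ℤ) - (k : ℤ))) ^ (j : ℕ) := fun j => by
      rw [conjTranspose_apply, of_apply, of_apply, star_mul', star_pow, hconj, star_inv₀,
        Complex.star_def, Complex.conj_ofReal, ← hsq, zpow_sub₀ hζ0, div_pow, zpow_natCast,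
        zpow_natCast, ← pow_mul, ← pow_mul, mul_comm (k : ℕ), mul_comm (l : ℕ), inv_pow, mul_inv,
        div_eq_mul_inv]
      ring
    rw [Finset.sum_congr rfl fun j _ => hterm j, ← Finset.mul_sum,
      Fin.sum_univ_eq_sum_range fun j => (ζ ^ ((l : ℤ) - (k : ℤ))) ^ j]
    by_cases hkl : k = l
    · subst hkl
      simp [hn0]
    · rw [one_apply_ne hkl]
      -- Distinct columns are orthogonal by a geometric sum; its ratio is not 1 because `|l - k| <
      -- n`.
      have hne : ζ ^ ((l : ℤ) - (k : ℤ)) ≠ 1 := fun h => by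
        rw [hζ.zpow_eq_one_iff_dvd] at h
        have := Int.eq_zero_of_abs_lt_dvd h (by rw [abs_lt]; omega)
        exact hkl (Fin.ext (by omega))
      have hp : (ζ ^ ((l : ℤ) - (k : ℤ))) ^ n = 1 := by
        rw [← _root_.zpow_natCast, ← _root_.zpow_mul, mul_comm, _root_.zpow_mul, _root_.zpow_natCast, hζ.pow_eq_one,
          _root_.one_zpow]
      rw [geom_sum_eq hne, hp]
      simp
  · intro j k
    rw [of_apply, Complex.normSq_mul, Complex.normSq_inv, Complex.normSq_ofReal,
      Real.mul_self_sqrt (Nat.cast_nonneg n), Complex.normSq_eq_norm_sq, norm_pow, hnorm]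
    simp

open Matrix in
/-- Every complex square matrix is unitarily similar to one whose diagonal has constant
real part. -/
theorem exists_unitary_re_diag_eq {n : ℕ} (G : Matrix (Fin n) (Fin n) ℂ) :
    ∃ U : Matrix (Fin n) (Fin n) ℂ, Uᴴ * U = 1 ∧
      ∀ k, ((Uᴴ * G * U) k k).re = G.trace.re / n := by
  have hH : (G + Gᴴ).IsHermitian := by
    rw [IsHermitian, conjTranspose_add, conjTranspose_conjTranspose, add_comm]
  obtain ⟨F, hF, hF1⟩ := exists_unitary_normSq_eq n
  set W : Matrix (Fin n) (Fin n) ℂ := hH.eigenvectorUnitary.1 with hW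
  have hWW : Wᴴ * W = 1 := mem_unitaryGroup_iff'.mp hH.eigenvectorUnitary.2
  have hD : Wᴴ * (G + Gᴴ) * W = diagonal fun j => (hH.eigenvalues j : ℂ) := by
    have h := hH.spectral_theorem
    rw [Unitary.conjStarAlgAut_apply] at h
    change G + Gᴴ = W * diagonal (fun j => (hH.eigenvalues j : ℂ)) * Wᴴ at h
    calc _ = Wᴴ * (W * diagonal (fun j => (hH.eigenvalues j : ℂ)) * Wᴴ) * W :=
          congrArg (fun X => Wᴴ * X * W) h
      _ = (Wᴴ * W) * diagonal (fun j => (hH.eigenvalues j : ℂ)) * (Wᴴ * W) := by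
          simp only [Matrix.mul_assoc]
      _ = _ := by rw [hWW, Matrix.one_mul, Matrix.mul_one]
  have htr : ∑ j, hH.eigenvalues j = 2 * G.trace.re := by
    have h := hH.trace_eq_sum_eigenvalues
    rw [trace_add, trace_conjTranspose] at h
    have := congrArg Complex.re h
    simp at this
    linarith
  -- `W` diagonalises the Hermitian part; since `|F j k|² = 1 / n`, conjugating by `F` replaces each
  -- diagonal entry by the mean of the eigenvalues.
  refine ⟨W * F, ?_, fun k => ?_⟩
  · rw [conjTranspose_mul, Matrix.mul_assoc, ← Matrix.mul_assoc Wᴴ, hWW, Matrix.one_mul, hF]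
  have h1 : (W * F)ᴴ * (G + Gᴴ) * (W * F)
      = (W * F)ᴴ * G * (W * F) + ((W * F)ᴴ * G * (W * F))ᴴ := by
    rw [conjTranspose_mul ((W * F)ᴴ * G), conjTranspose_mul (W * F)ᴴ, conjTranspose_conjTranspose,
      Matrix.mul_add, Matrix.add_mul, Matrix.mul_assoc (W * F)ᴴ Gᴴ]
  have h2 : (W * F)ᴴ * (G + Gᴴ) * (W * F)
      = Fᴴ * (diagonal fun j => (hH.eigenvalues j : ℂ)) * F := by
    rw [← hD, conjTranspose_mul]
    simp only [Matrix.mul_assoc]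
  have h3 : (Fᴴ * (diagonal fun j => (hH.eigenvalues j : ℂ)) * F) k k
      = ((2 * G.trace.re / n : ℝ) : ℂ) := by
    rw [mul_apply, ← htr, Finset.sum_div, Complex.ofReal_sum]
    refine Finset.sum_congr rfl fun j _ => ?_
    rw [mul_diagonal, conjTranspose_apply, mul_right_comm, Complex.star_def,
      ← Complex.normSq_eq_conj_mul_self, hF1, ← Complex.ofReal_mul]
    congr 1
    ring
  have h4 := congrArg Complex.re (congrFun (congrFun (h1.symm.trans h2) k) k)
  rw [h3, Matrix.add_apply, conjTranspose_apply, Complex.add_re, Complex.star_def, Complex.conj_re,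
    Complex.ofReal_re] at h4
  linarith [mul_div_assoc 2 G.trace.re n]

open Matrix in
/-- An eigenvector for a point in the spectrum of a complex matrix. -/
theorem exists_mulVec_eq_smul_of_mem_spectrum {ι : Type*} [Fintype ι] [DecidableEq ι]
    {N : Matrix ι ι ℂ} {z : ℂ} (hz : z ∈ spectrum ℂ N) : ∃ v, v ≠ 0 ∧ N *ᵥ v = z • v := by
  rw [spectrum.mem_iff, isUnit_iff_isUnit_det, isUnit_iff_ne_zero, not_not] at hz
  obtain ⟨v, hv, h⟩ := exists_mulVec_eq_zero_iff.mpr hz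
  refine ⟨v, hv, ?_⟩
  rw [sub_mulVec, sub_eq_zero, algebraMap_eq_diagonal] at h
  rw [← h]
  ext a
  simp [mulVec_diagonal]

open Matrix in
/-- Block form of a matrix in the coordinates in which `[[R, -S], [S, R]]` becomes
`diag(R + iS, R - iS)`. -/
theorem complex_coordinates_mul {m : Type*} [Fintype m] [DecidableEq m]
    (U U' W W' A₁ A₂ A₃ A₄ : Matrix m m ℂ) :
    fromBlocks U' (Complex.I • U') W' (-Complex.I • W') * fromBlocks A₁ A₂ A₃ A₄ *
        fromBlocks U W (-Complex.I • U) (Complex.I • W) =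
      fromBlocks (U' * (A₁ + A₄ + Complex.I • (A₃ - A₂)) * U)
        (U' * (A₁ - A₄ + Complex.I • (A₃ + A₂)) * W)
        (W' * (A₁ - A₄ - Complex.I • (A₃ + A₂)) * U)
        (W' * (A₁ + A₄ - Complex.I • (A₃ - A₂)) * W) := by
  have hI : ∀ X : Matrix m m ℂ, Complex.I • Complex.I • X = -X := fun X => by
    rw [smul_smul, Complex.I_mul_I, neg_one_smul]
  rw [fromBlocks_multiply, fromBlocks_multiply]
  congr 1 <;>
  · simp only [Matrix.mul_add, Matrix.add_mul, Matrix.mul_sub, Matrix.sub_mul, Matrix.smul_mul,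
      Matrix.mul_smul, neg_smul, Matrix.mul_neg, Matrix.neg_mul, smul_add, smul_sub, smul_neg, hI]
    abel

theorem theorem4p1 (n : ℕ) (A : Matrix (Fin n ⊕ Fin n) (Fin n ⊕ Fin n) ℝ)
    (hA : A.trace < 0) :
    ∃ M : Matrix (Fin n ⊕ Fin n) (Fin n ⊕ Fin n) ℝ,
      M.transpose = -M ∧ IsHamiltonianMatrix M ∧
        ∀ z ∈ spectrum ℂ ((A + M).map (fun x : ℝ => (x : ℂ))), z.re < 0 := by
  have hn : 0 < n := by
    rcases Nat.eq_zero_or_pos n with rfl | h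
    · simp [Matrix.trace] at hA
    · exact h
  set c : ℝ → ℂ := fun x => (x : ℂ) with hc
  set σ := starRingEnd ℂ with hσ
  set A₁ := A.toBlocks₁₁.map c with hA₁
  set A₂ := A.toBlocks₁₂.map c with hA₂
  set A₃ := A.toBlocks₂₁.map c with hA₃
  set A₄ := A.toBlocks₂₂.map c with hA₄
  have hAc : A.map c = Matrix.fromBlocks A₁ A₂ A₃ A₄ := by
    conv_lhs => rw [← Matrix.fromBlocks_toBlocks A]
    rw [Matrix.fromBlocks_map]
  set G := A₁ + A₄ + Complex.I • (A₃ - A₂) with hG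
  have hGtr : G.trace.re = A.trace := by
    simp [hG, hA₁, hA₂, hA₃, hA₄, hc, Matrix.trace, Matrix.toBlocks₁₁, Matrix.toBlocks₁₂,
      Matrix.toBlocks₂₁, Matrix.toBlocks₂₂, Finset.sum_add_distrib]
  have hGconj : A₁ + A₄ - Complex.I • (A₃ - A₂) = G.map σ := by
    ext a b
    simp [hG, hA₁, hA₂, hA₃, hA₄, hc, hσ, Matrix.toBlocks₁₁, Matrix.toBlocks₁₂,
      Matrix.toBlocks₂₁, Matrix.toBlocks₂₂]
    ring
  obtain ⟨U, hU, hdiag⟩ := exists_unitary_re_diag_eq G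
  rw [hGtr] at hdiag
  have hneg : A.trace / n < 0 := div_neg_of_neg_of_pos hA (by exact_mod_cast hn)
  -- Conjugation also produces the frequencies `-(k + 1)`; the shift by 1 keeps the two families
  -- from meeting at 0.
  set D : Matrix (Fin n) (Fin n) ℂ := Matrix.diagonal fun k => Complex.I * ((k : ℝ) + 1 : ℝ) with hD
  set K := U * D * U.conjTranspose with hK
  have hDskew : D.conjTranspose = -D := by
    rw [hD, Matrix.diagonal_conjTranspose, Matrix.diagonal_neg]
    congr 1
    ext k
    simp
  have hKskew : K.conjTranspose = -K := by
    rw [hK, Matrix.conjTranspose_mul, Matrix.conjTranspose_mul, Matrix.conjTranspose_conjTranspose,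
      hDskew, Matrix.neg_mul, Matrix.mul_neg, Matrix.mul_assoc]
  have hKentry : ∀ a b, σ (K b a) = -K a b := fun a b => congrFun (congrFun hKskew a) b
  have hKre : ∀ a b, (K b a).re = -(K a b).re := fun a b => by
    simpa [hσ] using congrArg Complex.re (hKentry a b)
  have hKim : ∀ a b, (K b a).im = (K a b).im := fun a b => by
    simpa [hσ] using congrArg Complex.im (hKentry a b)
  set R : Matrix (Fin n) (Fin n) ℝ := K.map Complex.re with hR
  set S : Matrix (Fin n) (Fin n) ℝ := K.map Complex.im with hS
  have hRT : R.transpose = -R := Matrix.ext hKre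
  have hST : S.transpose = S := Matrix.ext hKim
  have hRS : R.map c + R.map c + Complex.I • (S.map c - -S.map c) = (2 : ℂ) • K := by
    ext a b
    apply Complex.ext <;> simp [hR, hS, hc] <;> ring
  have hRS' : R.map c + R.map c - Complex.I • (S.map c - -S.map c) = (2 : ℂ) • K.map σ := by
    ext a b
    apply Complex.ext <;> simp [hR, hS, hc, hσ] <;> ring
  have hUKU : U.conjTranspose * K * U = D := by
    calc _ = (U.conjTranspose * U) * D * (U.conjTranspose * U) := by
          rw [hK]; simp only [Matrix.mul_assoc]
      _ = D := by rw [hU, Matrix.one_mul, Matrix.mul_one]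
  set P := Matrix.fromBlocks U.conjTranspose (Complex.I • U.conjTranspose)
    (U.conjTranspose.map σ) (-Complex.I • U.conjTranspose.map σ) with hP
  set V := Matrix.fromBlocks U (U.map σ) (-Complex.I • U) (Complex.I • U.map σ) with hV
  have hPV : ((1 / 2 : ℂ) • P) * V = 1 := by
    have h := complex_coordinates_mul U U.conjTranspose (U.map σ) (U.conjTranspose.map σ) 1 0 0 1
    rw [Matrix.fromBlocks_one, Matrix.mul_one] at h
    rw [Matrix.smul_mul, hP, hV, h, ← Matrix.fromBlocks_one, Matrix.fromBlocks_smul]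
    have h2 : (U.conjTranspose.map σ) * (U.map σ) = 1 := by
      rw [← Matrix.map_mul, hU, Matrix.map_one _ (map_zero σ) (map_one σ)]
    simp only [sub_self, add_zero, smul_zero, sub_zero, Matrix.mul_zero, Matrix.zero_mul,
      Matrix.mul_add, Matrix.add_mul, Matrix.mul_one, hU, h2]
    rw [← two_smul ℂ, smul_smul]
    norm_num
  have hVP : V * ((1 / 2 : ℂ) • P) = 1 := mul_eq_one_comm.mp hPV
  set B := ((1 / 2 : ℂ) • P) * A.map c * V with hB
  have hBblocks := complex_coordinates_mul U U.conjTranspose (U.map σ) (U.conjTranspose.map σ)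
    A₁ A₂ A₃ A₄
  rw [← hP, ← hV, ← hAc, ← hG, hGconj, ← Matrix.map_mul, ← Matrix.map_mul] at hBblocks
  -- Each diagonal entry has real part `tr A / (2n)`.
  have hBre : ∀ a, (B a a).re < 0 := fun a => by
    rw [hB, Matrix.smul_mul, Matrix.smul_mul, hBblocks]
    rcases a with k | k
    · have := hdiag k
      simp only [Matrix.smul_apply, Matrix.fromBlocks_apply₁₁, smul_eq_mul]
      simp
      linarith
    · have := hdiag k
      simp only [Matrix.smul_apply, Matrix.fromBlocks_apply₂₂, smul_eq_mul, Matrix.map_apply]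
      simp [hσ]
      linarith
  set l : Fin n ⊕ Fin n → ℝ := Sum.elim (fun k => (k : ℝ) + 1) (fun k => -((k : ℝ) + 1)) with hl
  have hsep : ∀ a b, a ≠ b → 1 ≤ |l a - l b| := by
    have hint : ∀ a : Fin n ⊕ Fin n, l a =
        (((Sum.elim (fun k => ((k : ℕ) : ℤ) + 1) fun k => -(((k : ℕ) : ℤ) + 1) :
          Fin n ⊕ Fin n → ℤ) a : ℤ) : ℝ) := by
      rintro (k | k) <;> simp [hl]
    intro a b hab
    rw [hint, hint, ← Int.cast_sub, ← Int.cast_abs]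
    norm_cast
    apply Int.one_le_abs
    rcases a with a | a <;> rcases b with b | b <;>
      simp only [Sum.elim_inl, Sum.elim_inr, ne_eq, Sum.inl.injEq, Sum.inr.injEq, Fin.ext_iff]
        at hab ⊢ <;> omega
  obtain ⟨t, ht⟩ := exists_stable_add_diagonal B l hsep hBre
  set M : Matrix (Fin n ⊕ Fin n) (Fin n ⊕ Fin n) ℝ := Matrix.fromBlocks R (-S) S R with hM
  have hMc : M.map c = Matrix.fromBlocks (R.map c) (-S.map c) (S.map c) (R.map c) := by
    rw [hM, Matrix.fromBlocks_map]
    congr 1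
    ext a b
    simp [hc]
  have hPMV : ((1 / 2 : ℂ) • P) * M.map c * V = Matrix.diagonal fun a => Complex.I * (l a : ℂ) := by
    have h := complex_coordinates_mul U U.conjTranspose (U.map σ) (U.conjTranspose.map σ)
      (R.map c) (-S.map c) (S.map c) (R.map c)
    have h2 : D.map σ = -D := by
      rw [← hDskew, hD, Matrix.diagonal_conjTranspose, Matrix.diagonal_map (map_zero σ)]
      rfl
    rw [Matrix.smul_mul, Matrix.smul_mul, hMc, hP, hV, h, hRS, hRS', sub_self, add_neg_cancel,
      smul_zero, add_zero, sub_zero, Matrix.mul_zero, Matrix.zero_mul, Matrix.mul_zero,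
      Matrix.zero_mul, Matrix.mul_smul, Matrix.smul_mul, Matrix.mul_smul, Matrix.smul_mul, hUKU,
      ← Matrix.map_mul, ← Matrix.map_mul, hUKU, h2, Matrix.fromBlocks_smul, smul_smul, smul_smul,
      smul_zero, hD, Matrix.diagonal_neg]
    norm_num
    exact ⟨fun a => by simp [hl], fun b => by simp [hl]; ring⟩
  refine ⟨t • M, ?_, ⟨t • R, -(t • S), t • S, ?_, ?_, ?_⟩, fun z hz => ?_⟩
  · rw [Matrix.transpose_smul, hM, Matrix.fromBlocks_transpose, Matrix.transpose_neg, hRT, hST,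
      ← smul_neg, Matrix.fromBlocks_neg, neg_neg]
  · rw [Matrix.IsSymm, Matrix.transpose_neg, Matrix.transpose_smul, hST]
  · rw [Matrix.IsSymm, Matrix.transpose_smul, hST]
  · rw [hM, Matrix.fromBlocks_smul, Matrix.transpose_smul, hRT, smul_neg, smul_neg, neg_neg]
  · obtain ⟨v, hv, hzv⟩ := exists_mulVec_eq_smul_of_mem_spectrum hz
    have hN : (A + t • M).map c = A.map c + (t : ℂ) • M.map c := by
      ext a b
      simp [hc]
    have hvw : V.mulVec (((1 / 2 : ℂ) • P).mulVec v) = v := by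
      rw [Matrix.mulVec_mulVec, hVP, Matrix.one_mulVec]
    refine ht z (((1 / 2 : ℂ) • P).mulVec v) (fun h => hv ?_) ?_
    · rw [← hvw, h, Matrix.mulVec_zero]
    · have hconj : (B + Matrix.diagonal fun a => (t : ℂ) * (Complex.I * (l a : ℂ)))
          = ((1 / 2 : ℂ) • P) * (A + t • M).map c * V := by
        have hd : (Matrix.diagonal fun a => (t : ℂ) * (Complex.I * (l a : ℂ)))
            = (t : ℂ) • Matrix.diagonal fun a => Complex.I * (l a : ℂ) := by
          rw [← Matrix.diagonal_smul]; rfl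
        rw [hN, Matrix.mul_add, Matrix.add_mul, Matrix.mul_smul _ (t : ℂ),
          Matrix.smul_mul (t : ℂ), hPMV, hd]
      rw [hconj, ← Matrix.mulVec_mulVec, hvw, ← Matrix.mulVec_mulVec, hzv, Matrix.mulVec_smul]
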